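/- Identify Boolean polynomials in $X_1,\dots,X_m$ (polynomials over $\mathbf F_2$ in which no variable occurs to a power higher than $1$) with their truth tables $\mathbf F_2^m\to\mathbf F_2$. Let $RM(r,m)$ be the set of Boolean polynomials of degree at most $r$ in $m$ variables (so $RM(-1,m)=\{0\}$), let $\mathrm{wt}(f)$ be the number of $v\in\mathbf F_2^m$ with $f(v)=1$, let the minimum weight of the coset $f+RM(r,m)$ be $\min_{p\in RM(r,m)}\mathrm{wt}(f+p)$, and let the covering radius of $RM(r-1,m)$ in $RM(r,m)$ be the maximum over $f\in RM(r,m)$ of the minimum weight of $f+RM(r-1,m)$. Consider $$f_1=0,\quad f_2=X_1X_2X_3,\quad f_3=X_1X_2X_3+X_2X_4X_5,\quad f_4=X_1X_2X_3+X_4X_5X_6,$$ $$f_5=X_1X_2X_3+X_2X_4X_5+X_3X_4X_6,\quad f_6=X_1X_2X_3+X_1X_4X_5+X_2X_4X_6+X_3X_5X_6+X_4X_5X_6$$ as Boolean polynomials in six variables. A level-$k$ certificate for a Boolean polynomial $f$ of degree $m-3$ in $m$ variables is a finite sequence of triples $\langle C,q,r\rangle$, where $C$ is a list of affine equations over $\mathbf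 F_2$ in variables $c_M$ indexed by the monomials $M$ of degree $m-4$, $q=[q_1,\dots,q_k]$ consists of polynomials of degree $2$, and $r=[r_1,\dots,r_k]$ consists of $\mathbf F_2$-linear combinations of the coefficient functionals $\mathrm{coef}(M)$, $M$ a monomial of degree $m-2$, such that: (1) the degree-$(m-2)$ parts of $X_1f,\dots,X_mf$ are linearly independent; and, for each triple, (2) each $q_jf$ has degree at most $m-2$; (3) for $j'<j$, whenever $C$ holds, the coefficient of $X_1\cdots X_m$ in $q_{j'}q_j(f+\sum_Mc_MM)$ is $0$; (4) $r_j(X_if)=0$ for all $i,j$; (5) for $j'\le j$, whenever $C$ holds, $r_j\bigl(q_{j'}(f+\sum_Mc_MM)\bigr)$ is $0$ if $j'<j$ and $1$ if $j'=j$; and finally (6) every assignment of values to the $c_M$ satisfies the condition $C$ of at least one triple. For $k=0$ the single triple of empty sequences is a certificate exactly when (1) holds. Write $c_{rs}$ and $\mathrm{coef}(rstu)$ for $c_{X_rX_s}$ and $\mathrm{coef}(X_rX_sX_tX_u)$. The following hold. (a) Each $f_i$ lies in $RM(3,6)$, and for every $f\in RM(3,6)$ there is exactly one $i\in\{1,\dots,6\}$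 such that $f\circ h-f_i\in RM(2,6)$ for some $h\in GL(6,2)$. (b) For $i=1,\dots,6$, both $\mathrm{wt}(f_i)$ and the minimum weight of $f_i+RM(2,6)$ are equal to $0,8,12,14,16,18$, respectively. Moreover $1+RM(-1,3)$ has minimum weight $8$ (three variables), and $X_1X_3+X_4X_5+RM(1,5)$ has minimum weight $12$ (in the five variables $X_1,X_3,X_4,X_5,X_6$). (c) If $f$, of degree $m-3$ in $m$ variables, has a level-$k$ certificate, then every element of $f+RM(m-4,m)$ has weight at least $2m+2k+2$. In particular (case $k=0$), this weight is at least $2m+2$ if the degree-$(m-2)$ parts of $X_1f,\dots,X_mf$ are linearly independent. (d) The single triple of empty sequences is a level-$0$ certificate for $X_1X_3+X_4X_5$ in the five variables $X_1,X_3,X_4,X_5,X_6$, and for $f_4$. A level-$1$ certificate for $f_5$ is $$\langle[c_{13}+c_{45}=0],\,[X_1X_2+X_4X_6],\,[\mathrm{coef}(1245)+\mathrm{coef}(1346)]\rangle,$$ $$\langle[c_{13}+c_{45}=1],\,[X_1X_3+X_4X_5],\,[\mathrm{coef}(1345)]\rangle,$$ and a level-$2$ certificate for $f_6$ is $$\langle[c_{34}=0,\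 c_{24}+c_{35}=0,\ c_{23}+c_{24}+c_{45}=0],\,[X_1X_5+X_2X_6,\ X_1X_2+X_1X_5+X_5X_6],$$ $$[\mathrm{coef}(1245)+\mathrm{coef}(2356),\ \mathrm{coef}(1235)+\mathrm{coef}(1245)+\mathrm{coef}(2456)]\rangle,$$ $$\langle[c_{34}=1],\,[X_1X_6,\ X_1X_5+X_2X_6],\,[\mathrm{coef}(1346),\ \mathrm{coef}(1234)+\mathrm{coef}(1345)+\mathrm{coef}(3456)]\rangle,$$ $$\langle[c_{23}+c_{24}+c_{45}=1],\,[X_1X_6,\ X_1X_5+X_2X_6],$$ $$[\mathrm{coef}(1236)+\mathrm{coef}(1246)+\mathrm{coef}(1456),\ \mathrm{coef}(1235)+\mathrm{coef}(1245)+\mathrm{coef}(2456)]\rangle,$$ $$\langle[c_{24}+c_{35}=1,\ c_{23}+c_{24}+c_{45}=0],\,[X_1X_6,\ X_1X_2+X_1X_5+X_5X_6],$$ $$[\mathrm{coef}(1246)+\mathrm{coef}(1356),\ \mathrm{coef}(1245)+\mathrm{coef}(2356)]\rangle.$$ (e) The covering radius of $RM(2,6)$ in $RM(3,6)$ is $18$.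 -/

import Mathlib

namespace ReedMuller

/-- An `m`-variable Boolean function, i.e. a truth table.  Sums and products are pointwise. -/
abbrev BoolFun (m : ℕ) : Type := (Fin m → ZMod 2) → ZMod 2

/-- An `m`-variable Boolean polynomial (no variable occurs to a power higher than `1`), given by
its coefficients: `a S` is the coefficient of the monomial `∏ i ∈ S, X i`. -/
abbrev BoolPoly (m : ℕ) : Type := Finset (Fin m) → ZMod 2

/-- The squarefree monomial `∏ i ∈ S, X i`, as a Boolean function. -/
def mono {m : ℕ} (S : Finset (Fin m)) : BoolFun m := fun v => ∏ i ∈ S, v i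

/-- The truth table of a Boolean polynomial. -/
def BoolPoly.eval {m : ℕ} (a : BoolPoly m) : BoolFun m :=
  fun v => ∑ S : Finset (Fin m), a S * mono S v

/-- The coefficients of the Boolean polynomial that represents a truth table, by Möbius
inversion; see `eval_anf` and `anf_eval`. -/
def anf {m : ℕ} (f : BoolFun m) : BoolPoly m :=
  fun S => ∑ T ∈ S.powerset, f (fun i => if i ∈ T then 1 else 0)

theorem mono_indicator {m : ℕ} (S T : Finset (Fin m)) :
    mono S (fun i => if i ∈ T then (1 : ZMod 2) else 0) = if S ⊆ T then 1 else 0 := by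
  unfold mono
  split_ifs with h
  · exact Finset.prod_eq_one fun i hi => if_pos (h hi)
  · obtain ⟨i, hi, hiT⟩ := Finset.not_subset.mp h
    exact Finset.prod_eq_zero hi (if_neg hiT)

theorem card_Icc_zmod {m : ℕ} (S U : Finset (Fin m)) :
    (∑ T ∈ U.powerset, if S ⊆ T then (1 : ZMod 2) else 0) = if S = U then 1 else 0 := by
  have e : (∑ T ∈ U.powerset, if S ⊆ T then (1 : ZMod 2) else 0)
      = ((Finset.Icc S U).card : ZMod 2) := by
    rw [Finset.sum_boole]
    congr 2
    ext T
    simp [Finset.mem_Icc, and_comm]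
  rw [e]
  split_ifs with h
  · subst h; simp
  · by_cases hs : S ⊆ U
    · rw [Finset.card_Icc_finset hs]
      have : U.card - S.card ≠ 0 := by
        have := Finset.card_lt_card (Finset.ssubset_iff_subset_ne.mpr ⟨hs, h⟩)
        omega
      have h2 : (2 : ZMod 2) = 0 := by decide
      push_cast
      rw [h2, zero_pow this]
    · rw [Finset.Icc_eq_empty hs]; simp

/-- A Boolean polynomial is determined by its truth table. -/
theorem anf_eval {m : ℕ} (a : BoolPoly m) : anf a.eval = a := by
  funext U
  unfold anf BoolPoly.eval
  rw [Finset.sum_comm]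
  simp_rw [mono_indicator, ← Finset.mul_sum, card_Icc_zmod]
  simp

/-- Every truth table is the truth table of a Boolean polynomial. -/
theorem eval_anf {m : ℕ} (f : BoolFun m) : (anf f).eval = f := by
  have hinj : Function.Injective (BoolPoly.eval (m := m)) :=
    Function.LeftInverse.injective (g := anf) anf_eval
  have hsurj : Function.Surjective (BoolPoly.eval (m := m)) := by
    apply ((Fintype.bijective_iff_injective_and_card _).mpr ⟨hinj, ?_⟩).2
    simp
  obtain ⟨a, rfl⟩ := hsurj f
  rw [anf_eval]

/-- The Reed-Muller code `RM(r,m)`: the truth tables of all Boolean polynomials of degree at most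
`r` on `m` variables.  For negative `r` it consists of `0` alone. -/
def RM (r : ℤ) (m : ℕ) : Set (BoolFun m) :=
  {f | ∃ a : BoolPoly m, (∀ S, a S ≠ 0 → (S.card : ℤ) ≤ r) ∧ a.eval = f}

/-- The number of inputs at which `f` takes the value `1`. -/
def weight {m : ℕ} (f : BoolFun m) : ℕ := (Finset.univ.filter fun v => f v = 1).card

/-- `w` is the minimum weight of the coset `f + C`, i.e. the distance from `f` to `C`. -/
def IsMinWeight {m : ℕ} (f : BoolFun m) (C : Set (BoolFun m)) (w : ℕ) : Prop :=
  IsLeast ((fun p => weight (f + p)) '' C) w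

/-- `ρ` is the covering radius of `C` in `D`: the maximum distance from an element of `D` to `C`. -/
def IsCoveringRadiusIn {m : ℕ} (C D : Set (BoolFun m)) (ρ : ℕ) : Prop :=
  IsGreatest {w | ∃ f ∈ D, IsMinWeight f C w} ρ

/-- The cosets `f + C` and `g + C` are equivalent under the action `f ↦ f ∘ h` of `GL(m,2)`
(for `C` a linear code that is invariant under this action). -/
def CosetEquiv {m : ℕ} (C : Set (BoolFun m)) (f g : BoolFun m) : Prop :=
  ∃ h : Matrix.GeneralLinearGroup (Fin m) (ZMod 2),
    (fun v => f (Matrix.mulVec (h : Matrix (Fin m) (Fin m) (ZMod 2)) v)) - g ∈ C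

/-- The variable `X i`. -/
def x {m : ℕ} (i : Fin m) : BoolFun m := fun v => v i

/-- The Boolean polynomial `f` is nonzero of degree `d`. -/
def HasDegree {m : ℕ} (f : BoolFun m) (d : ℤ) : Prop :=
  IsGreatest {e : ℤ | ∃ S, anf f S ≠ 0 ∧ (S.card : ℤ) = e} d

/-- The degree-`d` part of `f`. -/
def homogPart {m : ℕ} (d : ℤ) (f : BoolFun m) : BoolPoly m :=
  fun S => if (S.card : ℤ) = d then anf f S else 0

/-- The sum of the coefficients in `f` of the monomials in `r`. -/
def coefComb {m : ℕ} (r : Finset (Finset (Fin m))) (f : BoolFun m) : ZMod 2 := ∑ M ∈ r, anf f M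

/-- The affine equation `∑ M ∈ monos, c M = rhs` in variables `c M` indexed by monomials. -/
structure AffineEq (m : ℕ) where
  monos : Finset (Finset (Fin m))
  rhs : ZMod 2

/-- The assignment `c` satisfies all the equations in the list. -/
def Satisfies {m : ℕ} (c : Finset (Fin m) → ZMod 2) (C : List (AffineEq m)) : Prop :=
  ∀ e ∈ C, ∑ M ∈ e.monos, c M = e.rhs

/-- A triple `⟨C, q, r⟩`: affine conditions, `k` quadratics, and `k` linear combinations of
coefficient specifiers (over the two-element field, a linear combination is a finite set). -/
structure Subproof (m k : ℕ) where
  C : List (AffineEq m)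
  q : Fin k → BoolFun m
  r : Fin k → Finset (Finset (Fin m))

/-- `f + ∑ M, c M * M`, where `M` ranges over the monomials of degree `m - 4`. -/
def addCoquartic {m : ℕ} (f : BoolFun m) (c : Finset (Fin m) → ZMod 2) : BoolFun m :=
  f + ∑ M ∈ Finset.univ.filter (fun M : Finset (Fin m) => (M.card : ℤ) = m - 4), c M • mono M

/-- The sequence `L` of triples is a level-`k` certificate for `f`. -/
structure IsCertificate {m : ℕ} (f : BoolFun m) (k : ℕ) (L : List (Subproof m k)) : Prop where
  degree_f : HasDegree f (m - 3)
  monos_C : ∀ P ∈ L, ∀ e ∈ P.C, ∀ M ∈ e.monos, (M.card : ℤ) = m - 4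
  quadratic_q : ∀ P ∈ L, ∀ j, HasDegree (P.q j) 2
  monos_r : ∀ P ∈ L, ∀ j, ∀ M ∈ P.r j, (M.card : ℤ) = m - 2
  indep_old_old : LinearIndependent (ZMod 2) fun i : Fin m => homogPart (m - 2) (x i * f)
  orthog_old_new : ∀ P ∈ L, ∀ j, P.q j * f ∈ RM (m - 2) m
  orthog_new_new : ∀ P ∈ L, ∀ j' j, j' < j → ∀ c, Satisfies c P.C →
    anf (P.q j' * P.q j * addCoquartic f c) Finset.univ = 0
  indep_old_new : ∀ P ∈ L, ∀ (i : Fin m) j, coefComb (P.r j) (x i * f) = 0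
  indep_new_new : ∀ P ∈ L, ∀ j' j, j' ≤ j → ∀ c, Satisfies c P.C →
    coefComb (P.r j) (P.q j' * addCoquartic f c) = if j' = j then 1 else 0
  cover : ∀ c, ∃ P ∈ L, Satisfies c P.C

/-- The level-`0` certificate that consists of a single triple of null sequences. -/
def trivialCert (m : ℕ) : List (Subproof m 0) := [⟨[], ![], ![]⟩]

/-! Below, the variables `X_1, …, X_6` are `x 0, …, x 5`. -/

/-- `X₁X₂X₃` -/
def f₂ : BoolFun 6 := x 0 * x 1 * x 2

/-- `X₁X₂X₃ + X₂X₄X₅` -/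
def f₃ : BoolFun 6 := x 0 * x 1 * x 2 + x 1 * x 3 * x 4

/-- `X₁X₂X₃ + X₄X₅X₆` -/
def f₄ : BoolFun 6 := x 0 * x 1 * x 2 + x 3 * x 4 * x 5

/-- `X₁X₂X₃ + X₂X₄X₅ + X₃X₄X₆` -/
def f₅ : BoolFun 6 := x 0 * x 1 * x 2 + x 1 * x 3 * x 4 + x 2 * x 3 * x 5

/-- `X₁X₂X₃ + X₁X₄X₅ + X₂X₄X₆ + X₃X₅X₆ + X₄X₅X₆` -/
def f₆ : BoolFun 6 :=
  x 0 * x 1 * x 2 + x 0 * x 3 * x 4 + x 1 * x 3 * x 5 + x 2 * x 4 * x 5 + x 3 * x 4 * x 5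

/-- The six representatives, the first one being the zero polynomial. -/
def rep : Fin 6 → BoolFun 6 := ![0, f₂, f₃, f₄, f₅, f₆]

/-- The minimum weights of the six representative cosets. -/
def repWeight : Fin 6 → ℕ := ![0, 8, 12, 14, 16, 18]

/-- A quadratic in five variables; `f₃` is `X₂` times this quadratic in `X₁, X₃, X₄, X₅, X₆`. -/
def f₃red : BoolFun 5 := x 0 * x 1 + x 2 * x 3

/-- The triples
`⟨[c₁₃+c₄₅=0], [X₁X₂+X₄X₆], [coef(1245)+coef(1346)]⟩`,
`⟨[c₁₃+c₄₅=1], [X₁X₃+X₄X₅], [coef(1345)]⟩`. -/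
def cert₅ : List (Subproof 6 1) :=
  [⟨[⟨{{0, 2}, {3, 4}}, 0⟩],
    ![x 0 * x 1 + x 3 * x 5],
    ![{{0, 1, 3, 4}, {0, 2, 3, 5}}]⟩,
   ⟨[⟨{{0, 2}, {3, 4}}, 1⟩],
    ![x 0 * x 2 + x 3 * x 4],
    ![{{0, 2, 3, 4}}]⟩]

/-- The triples
`⟨[c₃₄=0, c₂₄+c₃₅=0, c₂₃+c₂₄+c₄₅=0], [X₁X₅+X₂X₆, X₁X₂+X₁X₅+X₅X₆],
  [coef(1245)+coef(2356), coef(1235)+coef(1245)+coef(2456)]⟩`,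
`⟨[c₃₄=1], [X₁X₆, X₁X₅+X₂X₆], [coef(1346), coef(1234)+coef(1345)+coef(3456)]⟩`,
`⟨[c₂₃+c₂₄+c₄₅=1], [X₁X₆, X₁X₅+X₂X₆],
  [coef(1236)+coef(1246)+coef(1456), coef(1235)+coef(1245)+coef(2456)]⟩`,
`⟨[c₂₄+c₃₅=1, c₂₃+c₂₄+c₄₅=0], [X₁X₆, X₁X₂+X₁X₅+X₅X₆],
  [coef(1246)+coef(1356), coef(1245)+coef(2356)]⟩`. -/
def cert₆ : List (Subproof 6 2) :=
  [⟨[⟨{{2, 3}}, 0⟩, ⟨{{1, 3}, {2, 4}}, 0⟩, ⟨{{1, 2}, {1, 3}, {3, 4}}, 0⟩],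
    ![x 0 * x 4 + x 1 * x 5, x 0 * x 1 + x 0 * x 4 + x 4 * x 5],
    ![{{0, 1, 3, 4}, {1, 2, 4, 5}}, {{0, 1, 2, 4}, {0, 1, 3, 4}, {1, 3, 4, 5}}]⟩,
   ⟨[⟨{{2, 3}}, 1⟩],
    ![x 0 * x 5, x 0 * x 4 + x 1 * x 5],
    ![{{0, 2, 3, 5}}, {{0, 1, 2, 3}, {0, 2, 3, 4}, {2, 3, 4, 5}}]⟩,
   ⟨[⟨{{1, 2}, {1, 3}, {3, 4}}, 1⟩],
    ![x 0 * x 5, x 0 * x 4 + x 1 * x 5],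
    ![{{0, 1, 2, 5}, {0, 1, 3, 5}, {0, 3, 4, 5}}, {{0, 1, 2, 4}, {0, 1, 3, 4}, {1, 3, 4, 5}}]⟩,
   ⟨[⟨{{1, 3}, {2, 4}}, 1⟩, ⟨{{1, 2}, {1, 3}, {3, 4}}, 0⟩],
    ![x 0 * x 5, x 0 * x 1 + x 0 * x 4 + x 4 * x 5],
    ![{{0, 1, 3, 5}, {0, 2, 4, 5}}, {{0, 1, 3, 4}, {1, 2, 4, 5}}]⟩]

end ReedMuller

/-!
The minimum weights come from two lower bounds that meet the weights of the representatives
themselves.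

Certificates (`IsCertificate.le_weight`). Let `g = f + p` with `f` of degree `m - 3` and `p` of
degree at most `m - 4`. The sum over the support of `g` of a product `u * v` is the coefficient of
the full monomial in `u * v * g`. For degree reasons this vanishes if `u`, `v` are among `1`, the
variables and the quadratics `q j` of a triple, with the exception of two distinct quadratics, and
there it vanishes by the conditions of the triple that applies to the part of `p` of degree `m - 4`.
The same conditions make these `1 + m + k` functions linearly independent on the support: the
functionals `r j` detect the quadratics, and the degree `m - 2` parts detect the variables. A
self-orthogonal code of dimension `n` has length at least `2 * n` (`two_mul_card_le_weight`), so the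
weight of `g` is at least `2 * (1 + m + k)`. This settles `f₄`, `f₅`, `f₆` and `f₃red`; the
conditions on the explicit certificates are affine in the unknown coefficients `c`, and become
finite checks (`isCertificate_of_check`).

Derivatives (`le_weight_of_derivative`). Restricting to the two values of a variable and adding does
not increase the weight and lowers the degree by one. This reduces `f₃` to `f₃red` and `f₂` to the
constant `1`.

Classification (`exists_cosetEquiv_rep`). A nonzero cubic part can be made to contain `X₁X₂X₃`, and
substitutions that add `X₄, X₅, X₆` to `X₁, X₂, X₃` then remove all `X_a X_b Y` with `X_a, X_b` among
the first and `Y` among the last three variables. What remains is a `3 × 3` matrix `B` of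
coefficients of the monomials with one of the first three variables, and the coefficient `d` of
`X₄X₅X₆`. Transvections within the two blocks of variables act on `B` as row and column operations
and fix `d`, so `B` becomes diagonal. The sixteen cubics that are left are images of the
representatives under short products of transvections. No two representatives are equivalent,
because the minimum weights of their cosets are distinct.
-/

namespace ReedMuller

/-! ### Degrees and Reed-Muller codes -/

/-- The coefficients of the Boolean polynomial of a truth table, as a linear map. -/
def anfₗ (m : ℕ) : BoolFun m →ₗ[ZMod 2] BoolPoly m where
  toFun := anf
  map_add' f g := by funext S; simp [anf, Finset.sum_add_distrib]
  map_smul' c f := by funext S; simp [anf, Finset.mul_sum]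

theorem anf_add {m : ℕ} (f g : BoolFun m) : anf (f + g) = anf f + anf g := (anfₗ m).map_add f g

theorem anf_smul {m : ℕ} (c : ZMod 2) (f : BoolFun m) : anf (c • f) = c • anf f :=
  (anfₗ m).map_smul c f

theorem anf_sum {m : ℕ} {ι : Type*} (s : Finset ι) (f : ι → BoolFun m) :
    anf (∑ i ∈ s, f i) = ∑ i ∈ s, anf (f i) := map_sum (anfₗ m) f s

@[simp] theorem anf_zero {m : ℕ} : anf (0 : BoolFun m) = 0 := (anfₗ m).map_zero

theorem anf_injective {m : ℕ} : Function.Injective (anf (m := m)) := fun f g h => by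
  rw [← eval_anf f, h, eval_anf]

theorem anf_mono {m : ℕ} (S U : Finset (Fin m)) : anf (mono S) U = if S = U then 1 else 0 := by
  unfold anf
  simp_rw [mono_indicator, card_Icc_zmod]

theorem eq_sum_mono {m : ℕ} (f : BoolFun m) : f = ∑ S, anf f S • mono S := by
  conv_lhs => rw [← eval_anf f]
  funext v
  simp [BoolPoly.eval]

/-- Every vector is the indicator of a set of coordinates. -/
def indicatorEquiv (m : ℕ) : Finset (Fin m) ≃ (Fin m → ZMod 2) where
  toFun T := fun i => if i ∈ T then 1 else 0
  invFun v := Finset.univ.filter fun i => v i = 1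
  left_inv T := by ext i; simp
  right_inv v := by
    funext i
    have : v i = 0 ∨ v i = 1 := by generalize v i = a; revert a; decide
    rcases this with h | h <;> simp [h]

/-- The coefficient of the full monomial is the sum of all values. -/
theorem anf_univ {m : ℕ} (f : BoolFun m) : anf f Finset.univ = ∑ v, f v := by
  unfold anf
  rw [Finset.powerset_univ]
  exact (indicatorEquiv m).sum_comp f

theorem mem_RM_iff {m : ℕ} {r : ℤ} {f : BoolFun m} :
    f ∈ RM r m ↔ ∀ S, r < S.card → anf f S = 0 := by
  constructor
  · rintro ⟨a, ha, rfl⟩ S hS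
    rw [anf_eval]
    by_contra h
    exact absurd (ha S h) (not_le.mpr hS)
  · intro h
    exact ⟨anf f, fun S hS => not_lt.mp fun h' => hS (h S h'), eval_anf f⟩

/-- `RM(r,m)` as a linear code. -/
def rmCode (r : ℤ) (m : ℕ) : Submodule (ZMod 2) (BoolFun m) where
  carrier := RM r m
  add_mem' {f g} hf hg := by
    rw [mem_RM_iff] at *
    intro S hS
    simp [anf_add, hf S hS, hg S hS]
  zero_mem' := by rw [mem_RM_iff]; simp
  smul_mem' c f hf := by
    rw [mem_RM_iff] at *
    intro S hS
    simp [anf_smul, hf S hS]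

theorem mem_rmCode {m : ℕ} {r : ℤ} {f : BoolFun m} : f ∈ rmCode r m ↔ f ∈ RM r m := Iff.rfl

theorem RM_mono {m : ℕ} {r s : ℤ} (h : r ≤ s) : RM r m ⊆ RM s m := fun f hf => by
  rw [mem_RM_iff] at *
  exact fun S hS => hf S (lt_of_le_of_lt h hS)

theorem mono_mem_RM {m : ℕ} {r : ℤ} (S : Finset (Fin m)) (h : (S.card : ℤ) ≤ r) :
    mono S ∈ RM r m := by
  rw [mem_RM_iff]
  intro U hU
  rw [anf_mono, if_neg]
  rintro rfl
  omega

/-- A linear map that sends monomials of degree at most `r` into `RM(s,n)` sends all of `RM(r,m)`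
into `RM(s,n)`. -/
theorem map_mem_RM {m n : ℕ} {r s : ℤ} (L : BoolFun m →ₗ[ZMod 2] BoolFun n)
    (hL : ∀ S : Finset (Fin m), (S.card : ℤ) ≤ r → L (mono S) ∈ RM s n) {f : BoolFun m}
    (hf : f ∈ RM r m) : L f ∈ RM s n := by
  rw [eq_sum_mono f, map_sum]
  refine (rmCode s n).sum_mem fun S _ => ?_
  rw [map_smul]
  by_cases h : (S.card : ℤ) ≤ r
  · exact (rmCode s n).smul_mem _ (hL S h)
  · rw [mem_RM_iff.mp hf S (not_le.mp h), zero_smul]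
    exact (rmCode s n).zero_mem

theorem mono_mul_mono {m : ℕ} (S T : Finset (Fin m)) : mono S * mono T = mono (S ∪ T) := by
  -- it suffices to compare values at indicator vectors
  funext v
  obtain ⟨U, rfl⟩ := (indicatorEquiv m).surjective v
  simp only [Pi.mul_apply, indicatorEquiv, Equiv.coe_fn_mk, mono_indicator, Finset.union_subset_iff]
  split_ifs <;> simp_all

theorem RM_mul {m : ℕ} {r s t : ℤ} (h : r + s ≤ t) {f g : BoolFun m} (hf : f ∈ RM r m)
    (hg : g ∈ RM s m) : f * g ∈ RM t m := by
  refine map_mem_RM (LinearMap.mulRight (ZMod 2) g) (fun S hS => ?_) hf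
  refine map_mem_RM (LinearMap.mulLeft (ZMod 2) (mono S)) (fun T hT => ?_) hg
  simp only [LinearMap.mulLeft_apply, mono_mul_mono]
  refine mono_mem_RM _ ?_
  have := Finset.card_union_le S T
  omega

theorem x_eq_mono {m : ℕ} (i : Fin m) : (x i : BoolFun m) = mono {i} := by
  funext v; simp [x, mono]

theorem x_mem_RM {m : ℕ} (i : Fin m) : (x i : BoolFun m) ∈ RM 1 m := by
  rw [x_eq_mono]; exact mono_mem_RM _ (by simp)

theorem one_mem_RM {m : ℕ} : (1 : BoolFun m) ∈ RM 0 m := by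
  have : (1 : BoolFun m) = mono ∅ := by funext v; simp [mono]
  rw [this]; exact mono_mem_RM _ (by simp)

theorem HasDegree.mem_RM {m : ℕ} {f : BoolFun m} {d : ℤ} (h : HasDegree f d) : f ∈ RM d m := by
  rw [mem_RM_iff]
  intro S hS
  by_contra h'
  exact absurd (h.2 ⟨S, h', rfl⟩) (not_le.mpr hS)

/-! ### Linear substitutions -/

/-- Substitution of linear forms for the variables. -/
def pullback {m : ℕ} (h : (Fin m → ZMod 2) →ₗ[ZMod 2] (Fin m → ZMod 2)) :
    BoolFun m →ₗ[ZMod 2] BoolFun m := LinearMap.funLeft (ZMod 2) (ZMod 2) h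

@[simp] theorem pullback_apply {m : ℕ} (h : (Fin m → ZMod 2) →ₗ[ZMod 2] (Fin m → ZMod 2))
    (f : BoolFun m) (v : Fin m → ZMod 2) : pullback h f v = f (h v) := rfl

theorem linear_mem_RM {m : ℕ} (l : (Fin m → ZMod 2) →ₗ[ZMod 2] ZMod 2) :
    (fun v => l v : BoolFun m) ∈ RM 1 m := by
  have : (fun v => l v : BoolFun m) = ∑ i, l (Pi.single i 1) • x i := by
    funext v
    conv_lhs => rw [LinearMap.pi_apply_eq_sum_univ l v]
    simp [x, mul_comm]
    refine Finset.sum_congr rfl fun i _ => ?_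
    congr 2
    funext j
    simp [Pi.single_apply, eq_comm]
  rw [this]
  exact (rmCode 1 m).sum_mem fun i _ => (rmCode 1 m).smul_mem _ (x_mem_RM i)

theorem prod_mem_RM {m : ℕ} {ι : Type*} (S : Finset ι) (l : ι → BoolFun m)
    (hl : ∀ i ∈ S, l i ∈ RM 1 m) : ∏ i ∈ S, l i ∈ RM S.card m := by
  classical
  induction S using Finset.induction_on with
  | empty => simpa using one_mem_RM
  | insert a S ha ih =>
    rw [Finset.prod_insert ha, Finset.card_insert_of_notMem ha]
    exact RM_mul (by push_cast; omega) (hl a (by simp)) (ih fun i hi => hl i (by simp [hi]))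

theorem pullback_mem_RM {m : ℕ} {r : ℤ} (h : (Fin m → ZMod 2) →ₗ[ZMod 2] (Fin m → ZMod 2))
    {f : BoolFun m} (hf : f ∈ RM r m) : pullback h f ∈ RM r m := by
  refine map_mem_RM (pullback h) (fun S hS => ?_) hf
  have : pullback h (mono S) = ∏ i ∈ S, fun v => (LinearMap.proj i ∘ₗ h) v := by
    funext v; simp [mono]
  rw [this]
  exact RM_mono hS (prod_mem_RM S _ fun i _ => linear_mem_RM _)

/-- Invertible matrices and linear automorphisms are the same substitutions. -/
theorem cosetEquiv_iff {m : ℕ} {C : Set (BoolFun m)} {f g : BoolFun m} :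
    CosetEquiv C f g ↔ ∃ e : (Fin m → ZMod 2) ≃ₗ[ZMod 2] (Fin m → ZMod 2),
      pullback (e : (Fin m → ZMod 2) →ₗ[ZMod 2] (Fin m → ZMod 2)) f - g ∈ C := by
  constructor
  · rintro ⟨h, hh⟩
    exact ⟨(LinearMap.GeneralLinearGroup.generalLinearEquiv _ _) (Matrix.GeneralLinearGroup.toLin h),
      hh⟩
  · rintro ⟨e, he⟩
    refine ⟨Matrix.GeneralLinearGroup.toLin.symm
      ((LinearMap.GeneralLinearGroup.generalLinearEquiv _ _).symm e), ?_⟩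
    convert he using 2
    funext v
    rw [pullback_apply]
    congr 1
    have := Matrix.GeneralLinearGroup.toLin_apply (Matrix.GeneralLinearGroup.toLin.symm
      ((LinearMap.GeneralLinearGroup.generalLinearEquiv _ _).symm e)) v
    rw [MulEquiv.apply_symm_apply] at this
    exact this.symm

theorem CosetEquiv.symm {m : ℕ} {r : ℤ} {f g : BoolFun m} (h : CosetEquiv (RM r m) f g) :
    CosetEquiv (RM r m) g f := by
  rw [cosetEquiv_iff] at *
  obtain ⟨e, he⟩ := h
  refine ⟨e.symm, ?_⟩
  have h1 := (rmCode r m).neg_mem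
    (pullback_mem_RM (e.symm : (Fin m → ZMod 2) →ₗ[ZMod 2] (Fin m → ZMod 2)) he)
  rw [mem_rmCode] at h1
  convert h1 using 1
  funext v
  simp

theorem CosetEquiv.trans {m : ℕ} {r : ℤ} {f g k : BoolFun m} (h : CosetEquiv (RM r m) f g)
    (h' : CosetEquiv (RM r m) g k) : CosetEquiv (RM r m) f k := by
  rw [cosetEquiv_iff] at *
  obtain ⟨e, he⟩ := h
  obtain ⟨e', he'⟩ := h'
  refine ⟨e'.trans e, ?_⟩
  have h1 := (rmCode r m).add_mem
    (pullback_mem_RM (e' : (Fin m → ZMod 2) →ₗ[ZMod 2] (Fin m → ZMod 2)) he) he'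
  rw [mem_rmCode] at h1
  convert h1 using 1
  funext v
  simp

theorem CosetEquiv.of_sub_mem {m : ℕ} {C : Set (BoolFun m)} {f g : BoolFun m} (h : f - g ∈ C) :
    CosetEquiv C f g := by
  rw [cosetEquiv_iff]
  exact ⟨LinearEquiv.refl _ _, h⟩

theorem CosetEquiv.refl {m : ℕ} (r : ℤ) (f : BoolFun m) : CosetEquiv (RM r m) f f :=
  CosetEquiv.of_sub_mem (by rw [sub_self]; exact (rmCode r m).zero_mem)

theorem cosetEquiv_pullback {m : ℕ} (r : ℤ) (f : BoolFun m)
    (e : (Fin m → ZMod 2) ≃ₗ[ZMod 2] (Fin m → ZMod 2)) :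
    CosetEquiv (RM r m) f (pullback (e : (Fin m → ZMod 2) →ₗ[ZMod 2] (Fin m → ZMod 2)) f) := by
  rw [cosetEquiv_iff]
  exact ⟨e, by rw [sub_self]; exact (rmCode r m).zero_mem⟩

theorem weight_pullback {m : ℕ} (f : BoolFun m)
    (e : (Fin m → ZMod 2) ≃ₗ[ZMod 2] (Fin m → ZMod 2)) :
    weight (pullback (e : (Fin m → ZMod 2) →ₗ[ZMod 2] (Fin m → ZMod 2)) f) = weight f := by
  unfold weight
  refine Finset.card_bij (fun v _ => e v)
    (fun v hv => Finset.mem_filter.mpr ⟨Finset.mem_univ _, (Finset.mem_filter.mp hv).2⟩)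
    (fun _ _ _ _ h => e.injective h) (fun w hw => ⟨e.symm w, ?_, e.apply_symm_apply w⟩)
  refine Finset.mem_filter.mpr ⟨Finset.mem_univ _, ?_⟩
  simpa using (Finset.mem_filter.mp hw).2

/-- Equivalent cosets have the same minimum weight, as `RM(r,m)` is invariant under `GL(m,2)`. -/
theorem CosetEquiv.isMinWeight {m : ℕ} {r : ℤ} {f g : BoolFun m} (h : CosetEquiv (RM r m) f g)
    {w : ℕ} (hw : IsMinWeight g (RM r m) w) : IsMinWeight f (RM r m) w := by
  have key : ∀ {f g : BoolFun m}, CosetEquiv (RM r m) f g →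
      ∀ p ∈ RM r m, ∃ p' ∈ RM r m, weight (g + p') = weight (f + p) := by
    intro f g h p hp
    obtain ⟨e, he⟩ := cosetEquiv_iff.mp h
    refine ⟨_, (rmCode r m).add_mem he
      (pullback_mem_RM (e : (Fin m → ZMod 2) →ₗ[ZMod 2] (Fin m → ZMod 2)) hp), ?_⟩
    rw [← weight_pullback (f + p) e, map_add]
    congr 1
    abel
  obtain ⟨⟨p, hp, hpw⟩, hmin⟩ := hw
  constructor
  · obtain ⟨p', hp', hw'⟩ := key h.symm p hp
    exact ⟨p', hp', hw'.trans hpw⟩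
  · rintro _ ⟨p, hp, rfl⟩
    obtain ⟨p', hp', hw'⟩ := key h p hp
    exact (hmin ⟨p', hp', rfl⟩).trans_eq hw'

/-! ### Self-orthogonal families and the certificate bound -/

/-- If the functions `u i`, restricted to the support of `g`, are linearly independent and span a
self-orthogonal code, then the support of `g` has at least twice as many elements. -/
theorem two_mul_card_le_weight {m : ℕ} {ι : Type*} [Fintype ι] (g : BoolFun m) (u : ι → BoolFun m)
    (hind : LinearIndependent (ZMod 2) fun i => u i * g)
    (horth : ∀ i j, anf (u i * u j * g) Finset.univ = 0) :
    2 * Fintype.card ι ≤ weight g := by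
  classical
  let W := {v : Fin m → ZMod 2 // g v = 1}
  have hg : ∀ v, g v = if g v = 1 then 1 else 0 := fun v => by
    generalize g v = a; revert a; decide
  let A : Matrix ι W (ZMod 2) := fun i w => u i w.1
  have hA : A * A.transpose = 0 := by
    ext i j
    have h := horth i j
    rw [anf_univ] at h
    rw [Matrix.mul_apply, Matrix.zero_apply, ← h]
    have h1 : ∀ v, (u i * u j * g) v = if g v = 1 then u i v * u j v else 0 := fun v => by
      simp only [Pi.mul_apply]
      split_ifs with hv
      · rw [hv, mul_one]
      · rw [hg v, if_neg hv, mul_zero]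
    simp_rw [h1]
    rw [← Finset.sum_filter]
    exact (Finset.sum_subtype (Finset.univ.filter fun v => g v = 1)
      (p := fun v => g v = 1) (by simp) fun v => u i v * u j v).symm
  have hrank : A.rank = Fintype.card ι := by
    refine LinearIndependent.rank_matrix (Fintype.linearIndependent_iff.mpr fun c hc => ?_)
    refine Fintype.linearIndependent_iff.mp hind c ?_
    funext v
    simp only [Finset.sum_apply, Pi.smul_apply, Pi.mul_apply, smul_eq_mul, Pi.zero_apply]
    by_cases hv : g v = 1
    · have := congrFun hc ⟨v, hv⟩
      simpa [A, Matrix.row, hv] using this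
    · rw [hg v, if_neg hv]
      simp
  have h := Matrix.rank_add_rank_le_card_of_mul_eq_zero hA
  rw [Matrix.rank_transpose, hrank] at h
  have hW : Fintype.card W = weight g := by
    rw [Fintype.card_subtype]; rfl
  omega

theorem coefComb_add {m : ℕ} (r : Finset (Finset (Fin m))) (f g : BoolFun m) :
    coefComb r (f + g) = coefComb r f + coefComb r g := by
  simp [coefComb, anf_add, Finset.sum_add_distrib]

theorem coefComb_zero {m : ℕ} (r : Finset (Finset (Fin m))) : coefComb r 0 = 0 := by
  simp [coefComb]

theorem coefComb_smul {m : ℕ} (r : Finset (Finset (Fin m))) (c : ZMod 2) (f : BoolFun m) :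
    coefComb r (c • f) = c * coefComb r f := by
  simp [coefComb, anf_smul, Finset.mul_sum]

theorem coefComb_sum {m : ℕ} {ι : Type*} (r : Finset (Finset (Fin m))) (s : Finset ι)
    (f : ι → BoolFun m) : coefComb r (∑ i ∈ s, f i) = ∑ i ∈ s, coefComb r (f i) := by
  simp only [coefComb, anf_sum, Finset.sum_apply]
  exact Finset.sum_comm

/-- Functions of small degree are invisible to combinations of coefficients of larger monomials. -/
theorem coefComb_eq_zero {m : ℕ} {d e : ℤ} {r : Finset (Finset (Fin m))} (h : e < d)
    (hr : ∀ M ∈ r, (M.card : ℤ) = d) {f : BoolFun m} (hf : f ∈ RM e m) : coefComb r f = 0 :=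
  Finset.sum_eq_zero fun M hM => mem_RM_iff.mp hf M (by rw [hr M hM]; exact h)

theorem anf_univ_eq_zero {m : ℕ} {r : ℤ} (h : r < m) {f : BoolFun m} (hf : f ∈ RM r m) :
    anf f Finset.univ = 0 := mem_RM_iff.mp hf _ (by simpa using h)

/-- Modulo degree `m - 5`, every element of the coset is of the form `addCoquartic f c`. -/
theorem add_sub_addCoquartic_mem {m : ℕ} (f : BoolFun m) {p : BoolFun m}
    (hp : p ∈ RM ((m : ℤ) - 4) m) : f + p - addCoquartic f (anf p) ∈ RM ((m : ℤ) - 5) m := by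
  rw [mem_RM_iff]
  intro S hS
  rw [addCoquartic, add_sub_add_left_eq_sub, sub_eq_add_neg, ← neg_one_smul (ZMod 2), anf_add,
    anf_smul, anf_sum]
  simp only [anf_smul, Pi.add_apply, Pi.smul_apply, Finset.sum_apply, anf_mono, smul_eq_mul,
    mul_ite, mul_one, mul_zero, Finset.sum_ite_eq']
  split_ifs with h
  · ring
  · rw [add_zero]
    refine mem_RM_iff.mp hp S ?_
    simp only [Finset.mem_filter, Finset.mem_univ, true_and] at h
    omega

/-- An upper unitriangular matrix has trivial kernel. -/
theorem eq_zero_of_unitriangular {k : ℕ} (A : Fin k → Fin k → ZMod 2) (h1 : ∀ j, A j j = 1)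
    (h0 : ∀ j' j, j' < j → A j j' = 0) (b : Fin k → ZMod 2) (hb : ∀ j, ∑ j', b j' * A j j' = 0) :
    b = 0 := by
  funext j
  induction j using WellFoundedGT.induction with
  | ind j ih =>
    have h := hb j
    rw [Finset.sum_eq_single j, h1, mul_one] at h
    · exact h
    · intro j' _ hne
      rcases lt_or_gt_of_ne hne with hlt | hgt
      · rw [h0 _ _ hlt, mul_zero]
      · rw [ih j' hgt, Pi.zero_apply, zero_mul]
    · simp

/-- The bound `2m + 2k + 2` from a level-`k` certificate: on the support of an element `f + p` of the
coset, the constant `1`, the variables and the quadratics of the triple that applies to `p` are a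
basis of a self-orthogonal code. -/
theorem IsCertificate.le_weight {m k : ℕ} {f : BoolFun m} {L : List (Subproof m k)}
    (h : IsCertificate f k L) {p : BoolFun m} (hp : p ∈ RM ((m : ℤ) - 4) m) :
    2 * m + 2 * k + 2 ≤ weight (f + p) := by
  obtain ⟨P, hPL, hc⟩ := h.cover (anf p)
  set g := f + p with hg
  have hfd : f ∈ RM ((m : ℤ) - 3) m := h.degree_f.mem_RM
  have hgd : g ∈ RM ((m : ℤ) - 3) m :=
    (rmCode _ m).add_mem hfd (RM_mono (by omega) hp)
  have hq : ∀ j, P.q j ∈ RM 2 m := fun j => (h.quadratic_q P hPL j).mem_RM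
  have hqg : ∀ j, P.q j * g ∈ RM ((m : ℤ) - 2) m := fun j => by
    rw [hg, mul_add]
    exact (rmCode _ m).add_mem (h.orthog_old_new P hPL j) (RM_mul (by omega) (hq j) hp)
  have hqq : ∀ j' j, j' < j → anf (P.q j' * P.q j * g) Finset.univ = 0 := fun j' j hj => by
    have h1 : P.q j' * P.q j * g = P.q j' * P.q j * addCoquartic f (anf p)
        + P.q j' * P.q j * (g - addCoquartic f (anf p)) := by ring
    rw [h1, anf_add, Pi.add_apply, h.orthog_new_new P hPL j' j hj _ hc, zero_add]
    exact anf_univ_eq_zero (by omega) (RM_mul le_rfl (RM_mul (t := 4) (by omega) (hq j') (hq j))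
      (add_sub_addCoquartic_mem f hp))
  have hrq : ∀ j' j, j' ≤ j → coefComb (P.r j) (P.q j' * g) = if j' = j then 1 else 0 :=
    fun j' j hj => by
    have h1 : P.q j' * g = P.q j' * addCoquartic f (anf p)
        + P.q j' * (g - addCoquartic f (anf p)) := by ring
    rw [h1, coefComb_add, h.indep_new_new P hPL j' j hj _ hc,
      coefComb_eq_zero (e := m - 3) (by omega) (h.monos_r P hPL j)
        (RM_mul (by omega) (hq j') (add_sub_addCoquartic_mem f hp)), add_zero]
  have hrx : ∀ (i : Fin m) j, coefComb (P.r j) (x i * g) = 0 := fun i j => by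
    rw [hg, mul_add, coefComb_add, h.indep_old_new P hPL i j,
      coefComb_eq_zero (e := m - 3) (by omega) (h.monos_r P hPL j)
        (RM_mul (by omega) (x_mem_RM i) hp), add_zero]
  have hrg : ∀ j, coefComb (P.r j) g = 0 := fun j =>
    coefComb_eq_zero (by omega) (h.monos_r P hPL j) hgd
  have hgne : g ≠ 0 := by
    obtain ⟨S, hS, hcard⟩ := h.degree_f.1
    intro h0
    have : anf g S = 0 := by rw [h0, anf_zero, Pi.zero_apply]
    rw [hg, anf_add, Pi.add_apply, mem_RM_iff.mp hp S (by omega), add_zero] at this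
    exact hS this
  let u : Option (Fin m ⊕ Fin k) → BoolFun m := fun i => i.elim 1 (Sum.elim x P.q)
  have key := two_mul_card_le_weight g u ?_ ?_
  · simp only [Fintype.card_option, Fintype.card_sum, Fintype.card_fin] at key
    omega
  · refine Fintype.linearIndependent_iff.mpr fun c hc0 => ?_
    rw [Fintype.sum_option, Fintype.sum_sum_type] at hc0
    simp only [u, Option.elim_none, Option.elim_some, Sum.elim_inl, Sum.elim_inr, one_mul] at hc0
    -- the functionals `P.r j` show that the quadratics do not occur
    have hb : (fun j => c (some (Sum.inr j))) = 0 := by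
      refine eq_zero_of_unitriangular (fun j j' => coefComb (P.r j) (P.q j' * g))
        (fun j => by simp [hrq j j le_rfl])
        (fun j' j hj => by simp [hrq j' j hj.le, hj.ne]) _ fun j => ?_
      have h1 := congrArg (coefComb (P.r j)) hc0
      simpa [coefComb_add, coefComb_sum, coefComb_smul, coefComb_zero, hrg, hrx] using h1
    have hb' : ∀ j, c (some (Sum.inr j)) = 0 := congrFun hb
    simp only [hb', zero_smul, Finset.sum_const_zero, add_zero] at hc0
    -- the parts of degree `m - 2` show that the variables do not occur
    have ha : ∀ i, c (some (Sum.inl i)) = 0 := by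
      refine Fintype.linearIndependent_iff.mp h.indep_old_old _ ?_
      funext S
      simp only [Finset.sum_apply, Pi.smul_apply, homogPart, smul_eq_mul, Pi.zero_apply]
      split_ifs with hS
      · have h1 := congrArg (fun f => anf f S) hc0
        have h2 : ∀ i : Fin m, anf (x i * g) S = anf (x i * f) S := fun i => by
          have h3 : x i * p ∈ RM ((m : ℤ) - 3) m := RM_mul (by omega) (x_mem_RM i) hp
          rw [hg, mul_add, anf_add, Pi.add_apply, mem_RM_iff.mp h3 S (by omega), add_zero]
        simpa [anf_add, anf_smul, anf_sum, mem_RM_iff.mp hgd S (by omega), h2] using h1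
      · simp
    simp only [ha, zero_smul, Finset.sum_const_zero, add_zero] at hc0
    have h1 : c none = 0 := (smul_eq_zero.mp hc0).resolve_right hgne
    rintro (_ | i | j)
    exacts [h1, ha i, hb' j]
  · -- all products have degree less than `m`, apart from those of two distinct quadratics
    have sq : ∀ f : BoolFun m, f * f = f := fun f => by
      funext v
      show f v * f v = f v
      generalize f v = a
      revert a; decide
    have low : ∀ {r : ℤ} {f : BoolFun m}, f ∈ RM r m → r < m → anf f Finset.univ = 0 :=
      fun hf hr => anf_univ_eq_zero hr hf
    have hxg : ∀ i, x i * g ∈ RM ((m : ℤ) - 2) m := fun i => RM_mul (by omega) (x_mem_RM i) hgd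
    have hxq : ∀ i j, x i * (P.q j * g) ∈ RM ((m : ℤ) - 1) m := fun i j =>
      RM_mul (by omega) (x_mem_RM i) (hqg j)
    rintro (_ | i | j) (_ | i' | j') <;>
      simp only [u, Option.elim_none, Option.elim_some, Sum.elim_inl, Sum.elim_inr, one_mul,
        mul_one]
    · exact low hgd (by omega)
    · exact low (hxg i') (by omega)
    · exact low (hqg j') (by omega)
    · exact low (hxg i) (by omega)
    · rw [mul_assoc]
      exact low (r := m - 1) (RM_mul (by omega) (x_mem_RM i) (hxg i')) (by omega)
    · rw [mul_assoc]
      exact low (hxq i j') (by omega)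
    · exact low (hqg j) (by omega)
    · rw [mul_comm (P.q j), mul_assoc]
      exact low (hxq i' j) (by omega)
    · rcases lt_trichotomy j j' with hlt | rfl | hlt
      · exact hqq j j' hlt
      · rw [sq]
        exact low (hqg j) (by omega)
      · rw [mul_comm (P.q j)]
        exact hqq j' j hlt

/-! ### Derivatives -/

/-- The derivative of `f` with respect to the variable `X i`, a function of the other variables. -/
def derivative {m : ℕ} (i : Fin (m + 1)) : BoolFun (m + 1) →ₗ[ZMod 2] BoolFun m where
  toFun f v := f (i.insertNth 0 v) + f (i.insertNth 1 v)
  map_add' f g := by funext v; simp; ring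
  map_smul' c f := by funext v; simp; ring

theorem derivative_apply {m : ℕ} (i : Fin (m + 1)) (f : BoolFun (m + 1)) (v : Fin m → ZMod 2) :
    derivative i f v = f (i.insertNth 0 v) + f (i.insertNth 1 v) := rfl

/-- Differentiation lowers the degree. -/
theorem derivative_mem_RM {m : ℕ} {r : ℤ} (i : Fin (m + 1)) {f : BoolFun (m + 1)}
    (hf : f ∈ RM r (m + 1)) : derivative i f ∈ RM (r - 1) m := by
  refine map_mem_RM (derivative i) (fun S hS => ?_) hf
  by_cases hi : i ∈ S
  · have h : derivative i (mono S)
        = ∏ j ∈ S.erase i, fun v => (i.insertNth 0 v : Fin (m + 1) → ZMod 2) j := by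
      funext v
      rw [derivative_apply, Finset.prod_apply]
      simp only [mono]
      rw [← Finset.mul_prod_erase S _ hi, ← Finset.mul_prod_erase S _ hi]
      simp only [Fin.insertNth_apply_same, zero_mul, one_mul, zero_add]
      refine Finset.prod_congr rfl fun j hj => ?_
      obtain ⟨j, rfl⟩ := Fin.exists_succAbove_eq (Finset.ne_of_mem_erase hj)
      simp
    rw [h]
    have h1 := prod_mem_RM (S.erase i) (fun j v => (i.insertNth 0 v : Fin (m + 1) → ZMod 2) j)
      fun j hj => by
        obtain ⟨j, rfl⟩ := Fin.exists_succAbove_eq (Finset.ne_of_mem_erase hj)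
        simp only [Fin.insertNth_apply_succAbove]
        exact x_mem_RM j
    refine RM_mono ?_ h1
    have := Finset.card_erase_add_one hi
    omega
  · have h : derivative i (mono S) = 0 := by
      funext v
      rw [derivative_apply]
      simp only [mono]
      have : ∏ j ∈ S, (i.insertNth 0 v : Fin (m + 1) → ZMod 2) j
          = ∏ j ∈ S, (i.insertNth 1 v : Fin (m + 1) → ZMod 2) j :=
        Finset.prod_congr rfl fun j hj => by
          have hne : j ≠ i := fun h => hi (h ▸ hj)
          obtain ⟨j, rfl⟩ := Fin.exists_succAbove_eq hne
          simp
      rw [this]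
      exact CharTwo.add_self_eq_zero _
    rw [h]
    exact (rmCode _ m).zero_mem

theorem weight_derivative_le {m : ℕ} (i : Fin (m + 1)) (f : BoolFun (m + 1)) :
    weight (derivative i f) ≤ weight f := by
  unfold weight
  -- where the derivative is `1`, exactly one of the two values of `f` is `1`
  refine Finset.card_le_card_of_injOn
    (fun v => i.insertNth (f (i.insertNth 1 v)) v) (fun v hv => ?_) fun v _ w _ h => ?_
  · have hv' : f (i.insertNth 0 v) + f (i.insertNth 1 v) = 1 := (Finset.mem_filter.mp hv).2
    refine Finset.mem_coe.mpr (Finset.mem_filter.mpr ⟨Finset.mem_univ _, ?_⟩)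
    have : ∀ a : ZMod 2, a = 0 ∨ a = 1 := by decide
    rcases this (f (i.insertNth 1 v)) with h | h
    · simp only [h]
      rwa [h, add_zero] at hv'
    · simp only [h]
  · exact ((Fin.insertNth_injective2 (p := i)) h).2

/-- The lower bound for the coset of a derivative is a lower bound for the coset itself. -/
theorem le_weight_of_derivative {m : ℕ} {r : ℤ} {w : ℕ} (i : Fin (m + 1)) (f : BoolFun (m + 1))
    (h : ∀ p ∈ RM (r - 1) m, w ≤ weight (derivative i f + p)) :
    ∀ p ∈ RM r (m + 1), w ≤ weight (f + p) := fun p hp =>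
  (h _ (derivative_mem_RM i hp)).trans (by
    rw [← map_add]; exact weight_derivative_le i (f + p))

theorem derivative_f₃ : derivative 1 f₃ = f₃red := by decide +kernel

theorem derivative_f₂ : derivative 0 (derivative 0 (derivative 0 f₂)) = 1 := by decide +kernel

theorem weight_rep (i : Fin 6) : weight (rep i) = repWeight i := by
  revert i
  decide +kernel

theorem weight_f₃red : weight f₃red = 12 := by decide +kernel

theorem weight_one : weight (1 : BoolFun 3) = 8 := by decide +kernel

/-- A lower bound for a coset that is the weight of its given element is the minimum weight. -/
theorem isMinWeight_self {m : ℕ} {r : ℤ} {f : BoolFun m} {w : ℕ} (hw : weight f = w)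
    (h : ∀ p ∈ RM r m, w ≤ weight (f + p)) : IsMinWeight f (RM r m) w :=
  ⟨⟨0, (rmCode r m).zero_mem, by simpa using hw⟩, by rintro _ ⟨p, hp, rfl⟩; exact h p hp⟩

theorem le_weight_one : ∀ p ∈ RM (-1) 3, 8 ≤ weight ((1 : BoolFun 3) + p) := by
  intro p hp
  have : p = 0 := anf_injective (funext fun S => by
    rw [mem_RM_iff.mp hp S (by omega), anf_zero, Pi.zero_apply])
  rw [this, add_zero, weight_one]

/-! ### Verification of the explicit certificates -/

/-- A combination of coefficients of `q * addCoquartic f c` is an affine function of `c`, and so it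
is constant where `C` holds if its linear part is the sum of those of some of the equations. -/
theorem coefComb_mul_addCoquartic {m : ℕ} {C : List (AffineEq m)}
    (hC : ∀ e ∈ C, ∀ M ∈ e.monos, (M.card : ℤ) = m - 4) {r : Finset (Finset (Fin m))}
    {q f : BoolFun m} {t : ZMod 2}
    (h : ∃ E ∈ C.sublists,
      (∀ M : Finset (Fin m), (M.card : ℤ) = m - 4 → coefComb r (q * mono M)
        = (E.map fun e => if M ∈ e.monos then (1 : ZMod 2) else 0).sum) ∧
      coefComb r (q * f) = t + (E.map AffineEq.rhs).sum)
    {c : Finset (Fin m) → ZMod 2} (hc : Satisfies c C) :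
    coefComb r (q * addCoquartic f c) = t := by
  obtain ⟨E, hE, hlin, hconst⟩ := h
  rw [List.mem_sublists] at hE
  -- evaluate the sum of the left-hand sides of the equations in `E`
  have key : ∀ E : List (AffineEq m), (∀ e ∈ E, e ∈ C) →
      ∑ M ∈ Finset.univ.filter (fun M : Finset (Fin m) => (M.card : ℤ) = m - 4),
        c M * (E.map fun e => if M ∈ e.monos then (1 : ZMod 2) else 0).sum
      = (E.map AffineEq.rhs).sum := by
    intro E
    induction E with
    | nil => simp
    | cons e E ih =>
      intro hE
      simp only [List.map_cons, List.sum_cons, mul_add, Finset.sum_add_distrib]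
      rw [ih fun e' he' => hE e' (by simp [he']), ← hc e (hE e (by simp))]
      congr 1
      simp only [mul_ite, mul_one, mul_zero]
      rw [← Finset.sum_filter]
      refine Finset.sum_congr ?_ fun _ _ => rfl
      ext M
      simp only [Finset.mem_filter, Finset.mem_univ, true_and]
      exact ⟨fun h => h.2, fun h => ⟨hC e (hE e (by simp)) M h, h⟩⟩
  rw [addCoquartic, mul_add, coefComb_add, hconst, Finset.mul_sum, coefComb_sum]
  have h1 : ∀ M ∈ Finset.univ.filter (fun M : Finset (Fin m) => (M.card : ℤ) = m - 4),
      coefComb r (q * c M • mono M)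
        = c M * (E.map fun e => if M ∈ e.monos then (1 : ZMod 2) else 0).sum := fun M hM => by
    rw [mul_smul_comm, coefComb_smul, hlin M (Finset.mem_filter.mp hM).2]
  rw [Finset.sum_congr rfl h1, key E fun e he => hE.subset he, add_assoc, CharTwo.add_self_eq_zero,
    add_zero]

/-- Functionals dual to the functions `x i * f` show that these are independent in degree
`m - 2`. -/
theorem linearIndependent_of_dual {m : ℕ} {f : BoolFun m} (r : Fin m → Finset (Finset (Fin m)))
    (hr : ∀ i, ∀ M ∈ r i, (M.card : ℤ) = m - 2)
    (h : ∀ i j, coefComb (r i) (x j * f) = if j = i then 1 else 0) :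
    LinearIndependent (ZMod 2) fun i : Fin m => homogPart (m - 2) (x i * f) := by
  refine Fintype.linearIndependent_iff.mpr fun c hc i => ?_
  have h1 : ∀ j, ∑ M ∈ r i, homogPart (m - 2) (x j * f) M = if j = i then 1 else 0 := fun j => by
    rw [← h i j]
    exact Finset.sum_congr rfl fun M hM => if_pos (hr i M hM)
  have h2 : ∑ M ∈ r i, (∑ j, c j • homogPart (m - 2) (x j * f)) M = 0 := by
    rw [hc]; simp
  simp only [Finset.sum_apply, Pi.smul_apply, smul_eq_mul] at h2
  rw [Finset.sum_comm] at h2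
  simpa [← Finset.mul_sum, h1] using h2


/-- A criterion for certificates without quantification over the unknown coefficients `c`, apart
from the covering condition. -/
theorem isCertificate_of_check {m k : ℕ} {f : BoolFun m} {L : List (Subproof m k)}
    (degree_f : (∃ S, anf f S ≠ 0 ∧ (S.card : ℤ) = m - 3) ∧
      ∀ S, anf f S ≠ 0 → (S.card : ℤ) ≤ m - 3)
    (monos_C : ∀ P ∈ L, ∀ e ∈ P.C, ∀ M ∈ e.monos, (M.card : ℤ) = m - 4)
    (quadratic_q : ∀ P ∈ L, ∀ j, (∃ S, anf (P.q j) S ≠ 0 ∧ (S.card : ℤ) = 2) ∧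
      ∀ S, anf (P.q j) S ≠ 0 → (S.card : ℤ) ≤ 2)
    (monos_r : ∀ P ∈ L, ∀ j, ∀ M ∈ P.r j, (M.card : ℤ) = m - 2)
    (dual : Fin m → Finset (Finset (Fin m))) (dual_card : ∀ i, ∀ M ∈ dual i, (M.card : ℤ) = m - 2)
    (dual_spec : ∀ i j, coefComb (dual i) (x j * f) = if j = i then 1 else 0)
    (orthog_old_new : ∀ P ∈ L, ∀ j, ∀ S, ((m : ℤ) - 2) < S.card → anf (P.q j * f) S = 0)
    (orthog_new_new : ∀ P ∈ L, ∀ j' j, j' < j → ∃ E ∈ P.C.sublists,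
      (∀ M : Finset (Fin m), (M.card : ℤ) = m - 4 →
        coefComb {Finset.univ} (P.q j' * P.q j * mono M)
          = (E.map fun e => if M ∈ e.monos then (1 : ZMod 2) else 0).sum) ∧
      coefComb {Finset.univ} (P.q j' * P.q j * f) = 0 + (E.map AffineEq.rhs).sum)
    (indep_old_new : ∀ P ∈ L, ∀ (i : Fin m) j, coefComb (P.r j) (x i * f) = 0)
    (indep_new_new : ∀ P ∈ L, ∀ j' j, j' ≤ j → ∃ E ∈ P.C.sublists,
      (∀ M : Finset (Fin m), (M.card : ℤ) = m - 4 → coefComb (P.r j) (P.q j' * mono M)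
        = (E.map fun e => if M ∈ e.monos then (1 : ZMod 2) else 0).sum) ∧
      coefComb (P.r j) (P.q j' * f) = (if j' = j then 1 else 0) + (E.map AffineEq.rhs).sum)
    (cover : ∀ c, ∃ P ∈ L, Satisfies c P.C) : IsCertificate f k L where
  degree_f := ⟨degree_f.1, by rintro _ ⟨S, h, rfl⟩; exact degree_f.2 S h⟩
  monos_C := monos_C
  quadratic_q P hP j := ⟨(quadratic_q P hP j).1, by
    rintro _ ⟨S, h, rfl⟩; exact (quadratic_q P hP j).2 S h⟩
  monos_r := monos_r
  indep_old_old := linearIndependent_of_dual dual dual_card dual_spec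
  orthog_old_new P hP j := mem_RM_iff.mpr (orthog_old_new P hP j)
  orthog_new_new P hP j' j hj c hc := by
    have := coefComb_mul_addCoquartic (monos_C P hP) (orthog_new_new P hP j' j hj) hc
    simpa [coefComb] using this
  indep_old_new := indep_old_new
  indep_new_new P hP j' j hj c hc :=
    coefComb_mul_addCoquartic (monos_C P hP) (indep_new_new P hP j' j hj) hc
  cover := cover

theorem isCertificate_f₃red : IsCertificate f₃red 0 (trivialCert 5) :=
  isCertificate_of_check (by decide +kernel) (by decide +kernel) (by decide +kernel)
    (by decide +kernel)
    ![{{0, 2, 3}}, {{1, 2, 3}}, {{0, 1, 2}}, {{0, 1, 3}}, {{0, 1, 4}}]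
    (by decide +kernel) (by decide +kernel) (by decide +kernel) (by decide +kernel)
    (by decide +kernel) (by decide +kernel)
    fun c => ⟨_, List.mem_singleton_self _, by simp [Satisfies]⟩

theorem isCertificate_f₄ : IsCertificate f₄ 0 (trivialCert 6) :=
  isCertificate_of_check (by decide +kernel) (by decide +kernel) (by decide +kernel)
    (by decide +kernel)
    ![{{0, 3, 4, 5}}, {{1, 3, 4, 5}}, {{2, 3, 4, 5}}, {{0, 1, 2, 3}}, {{0, 1, 2, 4}},
      {{0, 1, 2, 5}}]
    (by decide +kernel) (by decide +kernel) (by decide +kernel) (by decide +kernel)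
    (by decide +kernel) (by decide +kernel)
    fun c => ⟨_, List.mem_singleton_self _, by simp [Satisfies]⟩

theorem isCertificate_f₅ : IsCertificate f₅ 1 cert₅ :=
  isCertificate_of_check (by decide +kernel) (by decide +kernel) (by decide +kernel)
    (by decide +kernel)
    ![{{0, 1, 3, 4}}, {{1, 2, 3, 5}}, {{1, 2, 3, 4}}, {{0, 1, 2, 3}}, {{0, 1, 2, 4}},
      {{0, 1, 2, 5}}]
    (by decide +kernel) (by decide +kernel) (by decide +kernel) (by decide +kernel)
    (by decide +kernel) (by decide +kernel) fun c => by
      have h01 : ∀ a : ZMod 2, a = 0 ∨ a = 1 := by decide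
      rcases h01 (∑ M ∈ {{0, 2}, {3, 4}}, c M) with h | h <;> simp [cert₅, Satisfies, h]

theorem isCertificate_f₆ : IsCertificate f₆ 2 cert₆ :=
  isCertificate_of_check (by decide +kernel) (by decide +kernel) (by decide +kernel)
    (by decide +kernel)
    ![{{0, 1, 3, 5}}, {{0, 1, 3, 4}}, {{0, 2, 3, 4}}, {{0, 1, 2, 3}}, {{0, 1, 2, 4}},
      {{0, 1, 2, 5}}]
    (by decide +kernel) (by decide +kernel) (by decide +kernel) (by decide +kernel)
    (by decide +kernel) (by decide +kernel) fun c => by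
      have h01 : ∀ a : ZMod 2, a = 0 ∨ a = 1 := by decide
      -- the eight combinations of values of the three linear forms in the equations
      rcases h01 (∑ M ∈ {{2, 3}}, c M) with h | h <;>
      rcases h01 (∑ M ∈ {{1, 3}, {2, 4}}, c M) with h' | h' <;>
      rcases h01 (∑ M ∈ {{1, 2}, {1, 3}, {3, 4}}, c M) with h'' | h'' <;>
        simp only [cert₆, Satisfies, List.mem_cons, List.not_mem_nil, or_false, exists_eq_or_imp,
          exists_eq_left, forall_eq_or_imp, forall_eq, h, h', h''] <;> decide

/-! ### Transvections -/

/-- The substitution of `X i + X j` for `X i`. -/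
def addVar {m : ℕ} (i j : Fin m) (f : BoolFun m) : BoolFun m :=
  fun v => f (Function.update v i (v i + v j))

theorem exists_pullback_eq_addVar {m : ℕ} {i j : Fin m} (hij : i ≠ j) :
    ∃ e : (Fin m → ZMod 2) ≃ₗ[ZMod 2] (Fin m → ZMod 2), ∀ f : BoolFun m,
      addVar i j f = pullback (e : (Fin m → ZMod 2) →ₗ[ZMod 2] (Fin m → ZMod 2)) f := by
  let N : (Fin m → ZMod 2) →ₗ[ZMod 2] (Fin m → ZMod 2) :=
    { toFun := fun v => Function.update v i (v i + v j)
      map_add' := fun v w => by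
        funext k
        by_cases h : k = i
        · subst h; simp; ring
        · simp [h]
      map_smul' := fun c v => by
        funext k
        by_cases h : k = i
        · subst h; simp; ring
        · simp [h] }
  have hN : Function.Involutive N := fun v => by
    funext k
    show Function.update (Function.update v i (v i + v j)) i
      (Function.update v i (v i + v j) i + Function.update v i (v i + v j) j) k = v k
    rw [Function.update_self, Function.update_of_ne hij.symm, add_assoc,
      CharTwo.add_self_eq_zero, add_zero, Function.update_idem, Function.update_eq_self]
  exact ⟨LinearEquiv.ofInvolutive N hN, fun f => rfl⟩

theorem addVar_mem_RM {m : ℕ} {r : ℤ} {i j : Fin m} (hij : i ≠ j) {f : BoolFun m}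
    (hf : f ∈ RM r m) : addVar i j f ∈ RM r m := by
  obtain ⟨e, he⟩ := exists_pullback_eq_addVar hij
  rw [he]
  exact pullback_mem_RM _ hf

theorem cosetEquiv_addVar {m : ℕ} (r : ℤ) {i j : Fin m} (hij : i ≠ j) (f : BoolFun m) :
    CosetEquiv (RM r m) f (addVar i j f) := by
  obtain ⟨e, he⟩ := exists_pullback_eq_addVar hij
  rw [he]
  exact cosetEquiv_pullback r f e

theorem addVar_mono {m : ℕ} {i j : Fin m} (hij : i ≠ j) (U : Finset (Fin m)) :
    addVar i j (mono U) = mono U + if i ∈ U then mono (insert j (U.erase i)) else 0 := by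
  funext v
  have h0 : ∀ T : Finset (Fin m), i ∉ T →
      ∏ k ∈ T, Function.update v i (v i + v j) k = ∏ k ∈ T, v k := fun T hT =>
    Finset.prod_congr rfl fun k hk => Function.update_of_ne (by rintro rfl; exact hT hk) _ _
  have sq : v j * v j = v j := by generalize v j = a; revert a; decide
  by_cases hi : i ∈ U
  · rw [if_pos hi]
    simp only [addVar, mono, Pi.add_apply]
    rw [← Finset.mul_prod_erase U _ hi, h0 _ (Finset.notMem_erase i U),
      ← Finset.mul_prod_erase U v hi, Function.update_self, add_mul]
    congr 1
    by_cases hj : j ∈ U.erase i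
    · rw [Finset.insert_eq_of_mem hj, ← Finset.mul_prod_erase _ v hj, ← mul_assoc, sq]
    · rw [Finset.prod_insert hj]
  · rw [if_neg hi, add_zero]
    exact h0 U hi

/-- The effect of a transvection on the coefficients of highest degree. -/
theorem anf_addVar {m : ℕ} {i j : Fin m} (hij : i ≠ j) {r : ℤ} {f : BoolFun m}
    (hf : f ∈ RM r m) {S : Finset (Fin m)} (hS : (S.card : ℤ) = r) :
    anf (addVar i j f) S
      = anf f S + if j ∈ S ∧ i ∉ S then anf f (insert i (S.erase j)) else 0 := by
  obtain ⟨e, he⟩ := exists_pullback_eq_addVar hij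
  have h1 : anf (addVar i j f) S = ∑ U, anf f U * anf (addVar i j (mono U)) S := by
    rw [he]
    conv_lhs => rw [eq_sum_mono f, map_sum, anf_sum]
    simp [anf_smul, he]
  have h2 : ∀ U, anf f U * anf (addVar i j (mono U)) S = (if U = S then anf f U else 0)
      + if j ∈ S ∧ i ∉ S ∧ U = insert i (S.erase j) then anf f U else 0 := by
    intro U
    rw [addVar_mono hij, anf_add, Pi.add_apply, anf_mono, mul_add, mul_ite, mul_one, mul_zero]
    congr 1
    by_cases hU : (U.card : ℤ) ≤ r
    · by_cases hi : i ∈ U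
      · rw [if_pos hi, anf_mono, mul_ite, mul_one, mul_zero]
        refine if_congr ?_ rfl rfl
        constructor
        · rintro rfl
          have hj : j ∉ U := fun hj => by
            rw [Finset.insert_eq_of_mem (Finset.mem_erase.mpr ⟨hij.symm, hj⟩)] at hS
            have := Finset.card_erase_add_one hi
            omega
          refine ⟨Finset.mem_insert_self _ _, by simp [hij], ?_⟩
          rw [Finset.erase_insert (by simp [hj]), Finset.insert_erase hi]
        · rintro ⟨hj, hiS, rfl⟩
          rw [Finset.erase_insert (by simp [hiS]), Finset.insert_erase hj]
      · rw [if_neg hi, if_neg, anf_zero, Pi.zero_apply, mul_zero]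
        rintro ⟨-, -, rfl⟩
        simp at hi
    · rw [mem_RM_iff.mp hf U (not_le.mp hU)]
      simp
  rw [h1, Finset.sum_congr rfl fun U _ => h2 U, Finset.sum_add_distrib]
  congr 1
  · simp
  · by_cases h : j ∈ S ∧ i ∉ S
    · simp [h]
    · rw [if_neg h]
      refine Finset.sum_eq_zero fun U _ => if_neg fun h' => h ⟨h'.1, h'.2.1⟩

/-! ### The classification of cubics in six variables -/

/-- The variables `X₁, X₂, X₃`. -/
def lo (i : Fin 3) : Fin 6 := Fin.castAdd 3 i

/-- The variables `X₄, X₅, X₆`. -/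
def hi (i : Fin 3) : Fin 6 := Fin.natAdd 3 i

/-- The monomial that is the product of `hi j` and the two variables among `X₁, X₂, X₃` other than
`lo i`. -/
def oneHi (i j : Fin 3) : Finset (Fin 6) :=
  insert (hi j) (({0, 1, 2} : Finset (Fin 6)).erase (lo i))

/-- The monomial that is the product of `lo i` and the two variables among `X₄, X₅, X₆` other than
`hi j`. -/
def twoHi (i j : Fin 3) : Finset (Fin 6) :=
  insert (lo i) (({3, 4, 5} : Finset (Fin 6)).erase (hi j))

/-- For `f` of degree at most `3`: the cubic part of `f` is
`X₁X₂X₃ + ∑ B i j * twoHi i j + d X₄X₅X₆`. The condition on the degree is kept separate, so that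
this one is decidable by evaluation of twenty coefficients. -/
def HasForm (f : BoolFun 6) (B : Matrix (Fin 3) (Fin 3) (ZMod 2)) (d : ZMod 2) : Prop :=
  anf f {0, 1, 2} = 1 ∧ (∀ i j, anf f (oneHi i j) = 0) ∧ (∀ i j, anf f (twoHi i j) = B i j) ∧
    anf f {3, 4, 5} = d

/-- The twenty monomials of degree `3`. -/
theorem triple_cases : ∀ S : Finset (Fin 6), S.card = 3 →
    S = {0, 1, 2} ∨ (∃ i j, S = oneHi i j) ∨ (∃ i j, S = twoHi i j) ∨ S = {3, 4, 5} := by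
  decide +kernel

theorem card_oneHi : ∀ i j, (oneHi i j).card = 3 := by decide +kernel

theorem card_twoHi : ∀ i j, (twoHi i j).card = 3 := by decide +kernel

/-- Cubics with the same cubic part lie in the same coset. -/
theorem HasForm.cosetEquiv {f g : BoolFun 6} {B : Matrix (Fin 3) (Fin 3) (ZMod 2)} {d : ZMod 2}
    (hf3 : f ∈ RM 3 6) (hg3 : g ∈ RM 3 6) (hf : HasForm f B d) (hg : HasForm g B d) :
    CosetEquiv (RM 2 6) f g := by
  refine CosetEquiv.of_sub_mem (mem_RM_iff.mpr fun S hS => ?_)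
  rw [sub_eq_add_neg, ← neg_one_smul (ZMod 2), anf_add, anf_smul]
  show anf f S + -1 * anf g S = 0
  have h : anf f S = anf g S := by
    by_cases h3 : S.card = 3
    · rcases triple_cases S h3 with rfl | ⟨i, j, rfl⟩ | ⟨i, j, rfl⟩ | rfl
      · rw [hf.1, hg.1]
      · rw [hf.2.1, hg.2.1]
      · rw [hf.2.2.1, hg.2.2.1]
      · rw [hf.2.2.2, hg.2.2.2]
    · rw [mem_RM_iff.mp hf3 S (by omega), mem_RM_iff.mp hg3 S (by omega)]
  rw [h]; ring

/-- A cubic that contains a monomial `U` of degree `3` is equivalent to one that contains `X₁X₂X₃`,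
by induction on the number of variables of `U` other than `X₁, X₂, X₃`. -/
theorem exists_anf_eq_one (n : ℕ) : ∀ (f : BoolFun 6) (U : Finset (Fin 6)), f ∈ RM 3 6 →
    U.card = 3 → anf f U = 1 → (U \ {0, 1, 2}).card = n →
    ∃ g ∈ RM 3 6, CosetEquiv (RM 2 6) f g ∧ anf g {0, 1, 2} = 1 := by
  induction n with
  | zero =>
    intro f U hf hU h1 hn
    have : U = {0, 1, 2} := Finset.eq_of_subset_of_card_le
      (Finset.sdiff_eq_empty_iff_subset.mp (Finset.card_eq_zero.mp hn)) (by rw [hU]; decide)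
    exact ⟨f, hf, CosetEquiv.refl 2 _, this ▸ h1⟩
  | succ n ih =>
    intro f U hf hU h1 hn
    obtain ⟨i, hi, j, hj, hne, hcard, hS, hback, hjS, hiS⟩ :
        ∃ i ∈ U, ∃ j ∉ U, i ≠ j ∧ (insert j (U.erase i) \ {0, 1, 2}).card = n ∧
          (insert j (U.erase i)).card = 3 ∧
          insert i ((insert j (U.erase i)).erase j) = U ∧ j ∈ insert j (U.erase i) ∧
          i ∉ insert j (U.erase i) := by
      have key : ∀ U : Finset (Fin 6), U.card = 3 → U \ {0, 1, 2} ≠ ∅ →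
        ∃ i ∈ U, ∃ j ∉ U, i ≠ j ∧
          (insert j (U.erase i) \ {0, 1, 2}).card + 1 = (U \ {0, 1, 2}).card ∧
          (insert j (U.erase i)).card = 3 ∧
          insert i ((insert j (U.erase i)).erase j) = U ∧ j ∈ insert j (U.erase i) ∧
          i ∉ insert j (U.erase i) := by decide +kernel
      obtain ⟨i, hi, j, hj, hne, hcard, h⟩ := key U hU (fun h => by simp [h] at hn)
      exact ⟨i, hi, j, hj, hne, by omega, h⟩
    -- either the neighbour of `U` occurs in `f`, or the transvection makes it occur
    by_cases hfS : anf f (insert j (U.erase i)) = 1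
    · exact ih f _ hf hS hfS hcard
    · have hval := anf_addVar hne hf (S := insert j (U.erase i)) (by omega)
      rw [if_pos ⟨hjS, hiS⟩, hback, h1] at hval
      have h0 : anf f (insert j (U.erase i)) = 0 := by
        generalize anf f (insert j (U.erase i)) = a at hfS
        revert a; decide
      rw [h0, zero_add] at hval
      obtain ⟨g, hg, hfg, hg1⟩ := ih _ _ (addVar_mem_RM hne hf) hS hval hcard
      exact ⟨g, hg, (cosetEquiv_addVar 2 hne f).trans hfg, hg1⟩

theorem lo_ne_hi : ∀ i j, lo i ≠ hi j := by decide

/-- Completing the product: the monomials `oneHi` are absorbed into `X₁X₂X₃`. -/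
theorem exists_oneHi_eq_zero {f : BoolFun 6} (hf : f ∈ RM 3 6) (h1 : anf f {0, 1, 2} = 1)
    (s : Finset (Fin 3 × Fin 3)) :
    ∃ g ∈ RM 3 6, CosetEquiv (RM 2 6) f g ∧ anf g {0, 1, 2} = 1 ∧
      ∀ p ∈ s, anf g (oneHi p.1 p.2) = 0 := by
  induction s using Finset.induction_on with
  | empty =>
    exact ⟨f, hf, CosetEquiv.refl 2 _, h1,
      by simp⟩
  | insert p s _ ih =>
    obtain ⟨g, hg, hfg, hg1, hgs⟩ := ih
    by_cases hp : anf g (oneHi p.1 p.2) = 0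
    · refine ⟨g, hg, hfg, hg1, fun q hq => ?_⟩
      rcases Finset.mem_insert.mp hq with rfl | hq
      exacts [hp, hgs q hq]
    · -- adding `hi j` to `lo i` changes only the coefficient of `oneHi i j` among those of its kind
      have hne := lo_ne_hi p.1 p.2
      have hp1 : anf g (oneHi p.1 p.2) = 1 := by
        generalize anf g (oneHi p.1 p.2) = a at hp
        revert a; decide
      refine ⟨_, addVar_mem_RM hne hg, hfg.trans (cosetEquiv_addVar 2 hne g), ?_, fun q hq => ?_⟩
      · have key : ∀ i j, ¬(hi j ∈ ({0, 1, 2} : Finset (Fin 6)) ∧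
            lo i ∉ ({0, 1, 2} : Finset (Fin 6))) := by decide
        rw [anf_addVar hne hg (by decide), if_neg (key p.1 p.2), hg1, add_zero]
      · rw [anf_addVar hne hg (by rw [card_oneHi]; rfl)]
        by_cases hqp : q = p
        · have key : ∀ i j, (hi j ∈ oneHi i j ∧ lo i ∉ oneHi i j) ∧
              insert (lo i) ((oneHi i j).erase (hi j)) = {0, 1, 2} := by decide
          rw [hqp, if_pos (key p.1 p.2).1, (key p.1 p.2).2, hg1, hp1]
          rfl
        · have key : ∀ p q : Fin 3 × Fin 3, q ≠ p →
              ¬(hi p.2 ∈ oneHi q.1 q.2 ∧ lo p.1 ∉ oneHi q.1 q.2) := by decide +kernel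
          rw [if_neg (key p q hqp), add_zero]
          exact hgs q ((Finset.mem_insert.mp hq).resolve_left hqp)

/-- `X_j ↦ X_j + X_i` among the first three variables is a row operation on `B`. -/
theorem HasForm.addVar_lo {f : BoolFun 6} {B : Matrix (Fin 3) (Fin 3) (ZMod 2)} {d : ZMod 2}
    (hf3 : f ∈ RM 3 6) (hf : HasForm f B d) {i j : Fin 3} (hij : i ≠ j) :
    HasForm (addVar (lo j) (lo i) f) (Matrix.transvection i j 1 * B) d := by
  have hne : lo j ≠ lo i := by revert i j; decide
  have c3 : ∀ S : Finset (Fin 6), S.card = 3 → (S.card : ℤ) = 3 := fun S h => by omega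
  refine ⟨?_, fun a b => ?_, fun a b => ?_, ?_⟩
  · rw [anf_addVar hne hf3 (by decide), if_neg, hf.1, add_zero]
    revert i j; decide
  · rw [anf_addVar hne hf3 (c3 _ (card_oneHi a b)), hf.2.1, zero_add]
    split_ifs with h
    · have key : ∀ i j a b, i ≠ j → (lo i ∈ oneHi a b ∧ lo j ∉ oneHi a b) →
          insert (lo j) ((oneHi a b).erase (lo i)) = oneHi i b := by decide +kernel
      rw [key i j a b hij h, hf.2.1]
    · rfl
  · rw [anf_addVar hne hf3 (c3 _ (card_twoHi a b)), hf.2.2.1]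
    by_cases hai : a = i
    · subst hai
      have key : ∀ a j b, a ≠ j → (lo a ∈ twoHi a b ∧ lo j ∉ twoHi a b) ∧
          insert (lo j) ((twoHi a b).erase (lo a)) = twoHi j b := by decide +kernel
      rw [if_pos (key a j b hij).1, (key a j b hij).2, hf.2.2.1,
        Matrix.transvection_mul_apply_same, one_mul]
    · have key : ∀ a i b, a ≠ i → lo i ∉ twoHi a b := by decide +kernel
      rw [if_neg fun h => key a i b hai h.1, Matrix.transvection_mul_apply_of_ne _ _ _ _ hai,
        add_zero]
  · rw [anf_addVar hne hf3 (by decide), if_neg, hf.2.2.2, add_zero]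
    revert i j; decide

/-- `X_j ↦ X_j + X_i` among the last three variables is a column operation on `B`. -/
theorem HasForm.addVar_hi {f : BoolFun 6} {B : Matrix (Fin 3) (Fin 3) (ZMod 2)} {d : ZMod 2}
    (hf3 : f ∈ RM 3 6) (hf : HasForm f B d) {i j : Fin 3} (hij : i ≠ j) :
    HasForm (addVar (hi j) (hi i) f) (B * Matrix.transvection i j 1) d := by
  have hne : hi j ≠ hi i := by revert i j; decide
  have c3 : ∀ S : Finset (Fin 6), S.card = 3 → (S.card : ℤ) = 3 := fun S h => by omega
  refine ⟨?_, fun a b => ?_, fun a b => ?_, ?_⟩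
  · rw [anf_addVar hne hf3 (by decide), if_neg, hf.1, add_zero]
    revert i j; decide
  · rw [anf_addVar hne hf3 (c3 _ (card_oneHi a b)), hf.2.1, zero_add]
    split_ifs with h
    · have key : ∀ i j a b, i ≠ j → (hi i ∈ oneHi a b ∧ hi j ∉ oneHi a b) →
          insert (hi j) ((oneHi a b).erase (hi i)) = oneHi a j := by decide +kernel
      rw [key i j a b hij h, hf.2.1]
    · rfl
  · rw [anf_addVar hne hf3 (c3 _ (card_twoHi a b)), hf.2.2.1]
    by_cases hbj : b = j
    · subst hbj
      have key : ∀ i b a, i ≠ b → (hi i ∈ twoHi a b ∧ hi b ∉ twoHi a b) ∧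
          insert (hi b) ((twoHi a b).erase (hi i)) = twoHi a i := by decide +kernel
      rw [if_pos (key i b a hij).1, (key i b a hij).2, hf.2.2.1,
        Matrix.mul_transvection_apply_same, one_mul]
    · have key : ∀ a b j, b ≠ j → hi j ∈ twoHi a b := by decide +kernel
      rw [if_neg fun h => h.2 (key a b j hbj), Matrix.mul_transvection_apply_of_ne _ _ _ _ hbj,
        add_zero]
  · rw [anf_addVar hne hf3 (by decide), if_neg, hf.2.2.2, add_zero]
    revert i j; decide

/-- Products of transvections on the right of `B` are realized by substitutions. -/
theorem HasForm.exists_mul_list {f : BoolFun 6} {B : Matrix (Fin 3) (Fin 3) (ZMod 2)} {d : ZMod 2}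
    (hf3 : f ∈ RM 3 6) (hf : HasForm f B d)
    (L : List (Matrix.TransvectionStruct (Fin 3) (ZMod 2))) :
    ∃ g ∈ RM 3 6, CosetEquiv (RM 2 6) f g ∧
      HasForm g (B * (L.map Matrix.TransvectionStruct.toMatrix).prod) d := by
  induction L generalizing f B with
  | nil =>
    exact ⟨f, hf3, CosetEquiv.refl 2 _,
      by simpa using hf⟩
  | cons t L ih =>
    obtain ⟨i, j, hij, c⟩ := t
    have hc : c = 0 ∨ c = 1 := by revert c; decide
    rw [List.map_cons, List.prod_cons, ← mul_assoc]
    rcases hc with rfl | rfl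
    · simpa [Matrix.TransvectionStruct.toMatrix] using ih hf3 hf
    · have hne : hi j ≠ hi i := by revert i j; decide
      obtain ⟨g, hg3, hfg, hg⟩ := ih (addVar_mem_RM hne hf3) (hf.addVar_hi hf3 hij)
      exact ⟨g, hg3, (cosetEquiv_addVar 2 hne f).trans hfg, hg⟩

/-- Products of transvections on the left of `B` are realized by substitutions. -/
theorem HasForm.exists_list_mul {f : BoolFun 6} {B : Matrix (Fin 3) (Fin 3) (ZMod 2)} {d : ZMod 2}
    (hf3 : f ∈ RM 3 6) (hf : HasForm f B d)
    (L : List (Matrix.TransvectionStruct (Fin 3) (ZMod 2))) :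
    ∃ g ∈ RM 3 6, CosetEquiv (RM 2 6) f g ∧
      HasForm g ((L.map Matrix.TransvectionStruct.toMatrix).prod * B) d := by
  induction L with
  | nil =>
    exact ⟨f, hf3, CosetEquiv.refl 2 _,
      by simpa using hf⟩
  | cons t L ih =>
    obtain ⟨i, j, hij, c⟩ := t
    obtain ⟨g, hg3, hfg, hg⟩ := ih
    have hc : c = 0 ∨ c = 1 := by revert c; decide
    rw [List.map_cons, List.prod_cons, mul_assoc]
    rcases hc with rfl | rfl
    · exact ⟨g, hg3, hfg, by simpa [Matrix.TransvectionStruct.toMatrix] using hg⟩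
    · have hne : lo j ≠ lo i := by revert i j; decide
      exact ⟨_, addVar_mem_RM hne hg3, hfg.trans (cosetEquiv_addVar 2 hne g),
        hg.addVar_lo hg3 hij⟩

/-- Representatives, and transvections to be applied to them one after the other, that yield the
sixteen forms with a diagonal matrix. -/
def diagonalTable : List (Fin 6 × List (Fin 6 × Fin 6)) :=
  [(1, []),
   (2, [(1, 2), (2, 1)]),
   (2, [(4, 5), (5, 4)]),
   (2, [(1, 0), (0, 1), (3, 5), (5, 3)]),
   (3, []),
   (3, [(3, 0)]),
   (3, [(4, 1)]),
   (3, [(5, 2)]),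
   (3, [(0, 3), (4, 1), (5, 2)]),
   (3, [(1, 4), (3, 0), (5, 2)]),
   (3, [(2, 5), (3, 0), (4, 1)]),
   (4, [(1, 2), (2, 1), (1, 2)]),
   (4, [(1, 0), (0, 1), (2, 1), (1, 2), (3, 5), (5, 3)]),
   (4, [(1, 0), (0, 1), (3, 5), (5, 3), (5, 4), (4, 5)]),
   (4, [(1, 2), (1, 5), (2, 1), (1, 2), (1, 4), (3, 0)]),
   (5, [(0, 2), (2, 0), (0, 2)])]

/-- The composite of a list of transvections. -/
def addVars (w : List (Fin 6 × Fin 6)) (f : BoolFun 6) : BoolFun 6 :=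
  w.foldl (fun f p => addVar p.1 p.2 f) f

instance (f : BoolFun 6) (B : Matrix (Fin 3) (Fin 3) (ZMod 2)) (d : ZMod 2) :
    Decidable (HasForm f B d) := by
  have : ∀ i, Decidable (∀ j, anf f (twoHi i j) = B i j) := fun _ => inferInstance
  unfold HasForm
  infer_instance

theorem diagonalTable_spec : ∀ (D : Fin 3 → ZMod 2) (d : ZMod 2), ∃ t ∈ diagonalTable,
    HasForm (addVars t.2 (rep t.1)) (Matrix.diagonal D) d := by
  decide +kernel

theorem diagonalTable_ne : ∀ t ∈ diagonalTable, ∀ p ∈ t.2, p.1 ≠ p.2 := by decide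

theorem addVars_spec (w : List (Fin 6 × Fin 6)) (hw : ∀ p ∈ w, p.1 ≠ p.2) {f : BoolFun 6}
    (hf : f ∈ RM 3 6) : addVars w f ∈ RM 3 6 ∧ CosetEquiv (RM 2 6) f (addVars w f) := by
  induction w generalizing f with
  | nil => exact ⟨hf, CosetEquiv.refl 2 _⟩
  | cons p w ih =>
    have hp := hw p (by simp)
    obtain ⟨h1, h2⟩ := ih (fun q hq => hw q (by simp [hq])) (addVar_mem_RM hp hf)
    exact ⟨h1, (cosetEquiv_addVar 2 hp f).trans h2⟩

theorem rep_mem_RM (i : Fin 6) : rep i ∈ RM 3 6 := by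
  rw [mem_RM_iff]
  revert i
  decide +kernel

/-- Every cubic is equivalent, modulo quadratics, to one of the six representatives. -/
theorem exists_cosetEquiv_rep {f : BoolFun 6} (hf : f ∈ RM 3 6) :
    ∃ i, CosetEquiv (RM 2 6) f (rep i) := by
  by_cases h2 : f ∈ RM 2 6
  · exact ⟨0, CosetEquiv.of_sub_mem (by simpa [rep] using h2)⟩
  · obtain ⟨U, hU, hfU⟩ : ∃ U : Finset (Fin 6), U.card = 3 ∧ anf f U = 1 := by
      rw [mem_RM_iff] at h2
      push Not at h2
      obtain ⟨U, hU, hne⟩ := h2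
      have h3 : ¬((3 : ℤ) < U.card) := fun h => hne (mem_RM_iff.mp hf U h)
      refine ⟨U, by omega, ?_⟩
      generalize anf f U = a at hne
      revert a; decide
    obtain ⟨f₁, hf₁, e₁, h1⟩ := exists_anf_eq_one _ f U hf hU hfU rfl
    obtain ⟨f₂, hf₂, e₂, h1, h0⟩ := exists_oneHi_eq_zero hf₁ h1 Finset.univ
    obtain ⟨L, L', D, hD⟩ := Matrix.Pivot.exists_list_transvec_mul_mul_list_transvec_eq_diagonal
      (Matrix.of fun i j => anf f₂ (twoHi i j))
    have hform : HasForm f₂ (Matrix.of fun i j => anf f₂ (twoHi i j)) (anf f₂ {3, 4, 5}) :=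
      ⟨h1, fun i j => h0 (i, j) (Finset.mem_univ _), fun i j => rfl, rfl⟩
    obtain ⟨f₃, hf₃, e₃, hform⟩ := hform.exists_list_mul hf₂ L
    obtain ⟨f₄, hf₄, e₄, hform⟩ := hform.exists_mul_list hf₃ L'
    rw [hD] at hform
    obtain ⟨t, ht, htform⟩ := diagonalTable_spec D (anf f₂ {3, 4, 5})
    obtain ⟨ht3, htrep⟩ := addVars_spec t.2 (diagonalTable_ne t ht) (rep_mem_RM t.1)
    exact ⟨t.1, e₁.trans <| e₂.trans <| e₃.trans <| e₄.trans <|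
      (hform.cosetEquiv hf₄ ht3 htform).trans htrep.symm⟩

/-! ### Minimum weights -/

theorem le_weight_rep (i : Fin 6) : ∀ p ∈ RM 2 6, repWeight i ≤ weight (rep i + p) := by
  have cert : ∀ {k : ℕ} {f : BoolFun 6} {L : List (Subproof 6 k)}, IsCertificate f k L →
      ∀ p ∈ RM 2 6, 2 * 6 + 2 * k + 2 ≤ weight (f + p) := fun h p hp =>
    h.le_weight (RM_mono (by norm_num) hp)
  have h₂ : ∀ p ∈ RM 2 6, 8 ≤ weight (f₂ + p) := by
    -- three derivatives reduce the cubic to the constant `1`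
    refine le_weight_of_derivative 0 _ (le_weight_of_derivative 0 _
      (le_weight_of_derivative 0 _ ?_))
    rw [derivative_f₂]
    exact fun p hp => le_weight_one p (RM_mono (by norm_num) hp)
  have h₃ : ∀ p ∈ RM 2 6, 12 ≤ weight (f₃ + p) := by
    refine le_weight_of_derivative 1 _ ?_
    rw [derivative_f₃]
    exact fun p hp => isCertificate_f₃red.le_weight (RM_mono (by norm_num) hp)
  fin_cases i
  · exact fun p _ => Nat.zero_le _
  · exact h₂
  · exact h₃
  · exact cert isCertificate_f₄
  · exact cert isCertificate_f₅
  · exact cert isCertificate_f₆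

theorem isMinWeight_rep (i : Fin 6) : IsMinWeight (rep i) (RM 2 6) (repWeight i) :=
  isMinWeight_self (weight_rep i) (le_weight_rep i)

theorem repWeight_injective : Function.Injective repWeight := by decide

end ReedMuller

theorem mainTheorem9 :
    -- the six polynomials represent all cubics, exactly once each
    (∀ i, ReedMuller.rep i ∈ ReedMuller.RM 3 6) ∧
    (∀ f ∈ ReedMuller.RM 3 6, ∃! i, ReedMuller.CosetEquiv (ReedMuller.RM 2 6) f (ReedMuller.rep i)) ∧
    -- their weights and the minimum weights of their cosets
    (∀ i, ReedMuller.weight (ReedMuller.rep i) = ReedMuller.repWeight i ∧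
      ReedMuller.IsMinWeight (ReedMuller.rep i) (ReedMuller.RM 2 6) (ReedMuller.repWeight i)) ∧
    -- the polynomials in fewer variables to which the second and the third one reduce
    ReedMuller.IsMinWeight (1 : ReedMuller.BoolFun 3) (ReedMuller.RM (-1) 3) 8 ∧
    ReedMuller.IsMinWeight ReedMuller.f₃red (ReedMuller.RM 1 5) 12 ∧
    -- a level-`k` certificate implies the lower bound `2m + 2k + 2`
    (∀ (m k : ℕ) (f : ReedMuller.BoolFun m) (L : List (ReedMuller.Subproof m k)),
      ReedMuller.IsCertificate f k L →
      ∀ p ∈ ReedMuller.RM ((m : ℤ) - 4) m, 2 * m + 2 * k + 2 ≤ ReedMuller.weight (f + p)) ∧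
    -- the explicit certificates
    ReedMuller.IsCertificate ReedMuller.f₃red 0 (ReedMuller.trivialCert 5) ∧
    ReedMuller.IsCertificate ReedMuller.f₄ 0 (ReedMuller.trivialCert 6) ∧
    ReedMuller.IsCertificate ReedMuller.f₅ 1 ReedMuller.cert₅ ∧
    ReedMuller.IsCertificate ReedMuller.f₆ 2 ReedMuller.cert₆ ∧
    -- the covering radius
    ReedMuller.IsCoveringRadiusIn (ReedMuller.RM 2 6) (ReedMuller.RM 3 6) 18 := by
  refine ⟨ReedMuller.rep_mem_RM, fun f hf => ?_,
    fun i => ⟨ReedMuller.weight_rep i, ReedMuller.isMinWeight_rep i⟩,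
    ReedMuller.isMinWeight_self ReedMuller.weight_one ReedMuller.le_weight_one,
    ReedMuller.isMinWeight_self ReedMuller.weight_f₃red fun p hp =>
      ReedMuller.isCertificate_f₃red.le_weight (ReedMuller.RM_mono (by norm_num) hp),
    fun m k f L h p hp => h.le_weight hp, ReedMuller.isCertificate_f₃red,
    ReedMuller.isCertificate_f₄, ReedMuller.isCertificate_f₅, ReedMuller.isCertificate_f₆,
    ⟨_, ReedMuller.rep_mem_RM 5, ReedMuller.isMinWeight_rep 5⟩, ?_⟩
  · obtain ⟨i, hi⟩ := ReedMuller.exists_cosetEquiv_rep hf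
    -- the minimum weight of the coset determines the representative
    refine ⟨i, hi, fun j hj => ReedMuller.repWeight_injective ?_⟩
    exact (hj.isMinWeight (ReedMuller.isMinWeight_rep j)).unique
      (hi.isMinWeight (ReedMuller.isMinWeight_rep i))
  · rintro w ⟨f, hf, hw⟩
    obtain ⟨i, hi⟩ := ReedMuller.exists_cosetEquiv_rep hf
    rw [hw.unique (hi.isMinWeight (ReedMuller.isMinWeight_rep i))]
    exact (by decide : ∀ i, ReedMuller.repWeight i ≤ 18) i
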